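/- Let $p\in(0,1)$, $K>0$, $\gamma\in(0,1/2)$ and $d_0\in(0,1)$. **Regression function.** $f:[0,1]\to\mathbb R$ is increasing and differentiable on $[0,1]$ with $0<\inf_{[0,1]}f'\le\sup_{[0,1]}f'<\infty$; in a neighbourhood of $d_0$, $f'$ is positive and continuous and $f'''$ exists and is bounded. Put $\theta_0=f(d_0)$. (Where $f$ has to be evaluated outside $[0,1]$ it is extended arbitrarily.) **Design.** $\{x_{i,m}\}_{1\le i\le m}$, $m\ge 1$, is a triangular array with $0\le x_{1,m}<\dots<x_{m,m}\le 1$. There are a distribution function $G$, with a Lebesgue density that is positive and has a bounded first derivative on $[0,1]$, and a constant $C$ such that $\sup_{x\in[0,1]}|F_m(x)-G(x)|\le C m^{-1/2}$ for all $m\ge1$, where $F_m$ is the empirical distribution function of $x_{1,m},\dots,x_{m,m}$. **Errors.** For each $n$ let $n_1=\lfloor np\rfloor$ if $n-\lfloor np\rfloor$ is even, $n_1=\lfloor np\rfloor+1$ otherwise, and $n_2=(n-n_1)/2$. On a probability space $(\Omega,\mathscr A,P)$ there are random variables $\varepsilon_{i,n}$ ($i\le n_1$), $\varepsilon'_{i,n}$,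 $\varepsilon''_{i,n}$ ($i\le n_2$), all with the same law for all $i$ and $n$, with mean zero and all absolute moments finite, and for each $n$ the $n_1+2n_2$ variables with second index $n$ are mutually independent. **Two-stage procedure.** Let $\hat f_n$ be an isotonic regression estimate from the data $(x_{i,n_1},\,f(x_{i,n_1})+\varepsilon_{i,n})$, $i\le n_1$, that is, an increasing function on $[0,1]$ which minimises the residual sum of squares among all increasing functions on $[0,1]$. Let $\hat d=\inf\{x\in[0,1]:\hat f_n(x)\ge\theta_0\}$, $L=\hat d-Kn_1^{-\gamma}$, $U=\hat d+Kn_1^{-\gamma}$, $Y_i'=f(L)+\varepsilon'_{i,n}$ and $Y_i''=f(U)+\varepsilon''_{i,n}$ for $i\le n_2$. Let $(\hat\beta_0,\hat\beta_1)$ be a least squares fit of $y=\beta_0+\beta_1x$ to the $2n_2$ points $(L,Y_i'),(U,Y_i'')$. **Bootstrap.** Given the data, draw $Y_1'^\star,\dots,Y_{n_2}'^\star$ and $Y_1''^\star,\dots,Y_{n_2}''^\star$ independently, with replacement, from $\{Y_i'\}_{i\le n_2}$ and from $\{Y_i''\}_{i\le n_2}$ respectively. Let $(\hat\beta_0^\star,\hat\beta_1^\star)$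 be a least squares fit of $y=\beta_0+\beta_1x$ to the points $(L,Y_i'^\star),(U,Y_i''^\star)$, $i\le n_2$, and let $P^\star$ denote the probability of the resampling conditional on the data (that is, for fixed $\omega$). Then, as $n\to\infty$, $\hat\beta_1\to f'(d_0)$ $P$-almost surely; and for $P$-almost every $\omega$, $\hat\beta_1^\star\to f'(d_0)$ in $P^\star$-probability, that is, $P^\star(|\hat\beta_1^\star-f'(d_0)|\ge\delta)\to0$ for every $\delta>0$. -/

import Mathlib

open MeasureTheory ProbabilityTheory Filter Topology Set

noncomputable section

namespace TwoStage

/-- The regression functions that are increasing on `[0,1]` and have a positive and continuous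
first derivative in a neighbourhood of `d₀`. -/
def ClassF0 (d₀ : ℝ) : Set (ℝ → ℝ) :=
  {f | MonotoneOn f (Icc 0 1) ∧
    ∀ᶠ x in 𝓝 d₀, DifferentiableAt ℝ f x ∧ 0 < deriv f x ∧ ContinuousAt (deriv f) x}

/-- The members of `ClassF0 d₀` whose third derivative exists and is uniformly bounded in a
neighbourhood of `d₀`. -/
def ClassF (d₀ : ℝ) : Set (ℝ → ℝ) :=
  {f | f ∈ ClassF0 d₀ ∧ ∃ M : ℝ, ∀ᶠ x in 𝓝 d₀,
    (∀ k < 3, DifferentiableAt ℝ (iteratedDeriv k f) x) ∧ |iteratedDeriv 3 f x| ≤ M}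

/-- The empirical distribution function of the points `x 0, …, x (m - 1)`. -/
def empiricalCDF {m : ℕ} (x : Fin m → ℝ) (t : ℝ) : ℝ :=
  (Finset.univ.filter fun i => x i ≤ t).card / (m : ℝ)

/-- A triangular array of design points; row `m` consists of `m` increasing points of `[0,1]`. -/
def IsDesignArray (x : (m : ℕ) → Fin m → ℝ) : Prop :=
  ∀ m, StrictMono (x m) ∧ ∀ i, x m i ∈ Icc (0 : ℝ) 1

/-- Assumption (A2): the empirical distribution functions of the design approach, at the rate
`m ^ (-1/2)` uniformly on `[0,1]`, the distribution function of a law `ν` whose Lebesgue density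
`g` is positive on `[0,1]` and has a bounded first derivative there. -/
def AssumptionA2 (x : (m : ℕ) → Fin m → ℝ) : Prop :=
  ∃ (ν : Measure ℝ) (g : ℝ → ℝ),
    IsProbabilityMeasure ν ∧ Measurable g ∧ (∀ t, 0 ≤ g t) ∧
    ν = volume.withDensity (fun t => ENNReal.ofReal (g t)) ∧
    (∀ t ∈ Icc (0 : ℝ) 1, 0 < g t) ∧
    DifferentiableOn ℝ g (Icc 0 1) ∧
    (∃ B : ℝ, ∀ t ∈ Icc (0 : ℝ) 1, |derivWithin g (Icc 0 1) t| ≤ B) ∧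
    ∃ C : ℝ, ∀ m : ℕ, 0 < m → ∀ t ∈ Icc (0 : ℝ) 1,
      |empiricalCDF (x m) t - cdf ν t| ≤ C * (m : ℝ) ^ (-(1 / 2) : ℝ)

/-- Assumption (A3) (apart from membership in `ClassF0`): `f` is differentiable on `[0,1]`
(one-sidedly at the end points), and the infimum and the supremum of `f'` over `[0,1]` are positive
and finite. -/
def AssumptionA3 (f : ℝ → ℝ) : Prop :=
  DifferentiableOn ℝ f (Icc 0 1) ∧
    ∃ c C : ℝ, 0 < c ∧ ∀ x ∈ Icc (0 : ℝ) 1,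
      c ≤ derivWithin f (Icc 0 1) x ∧ derivWithin f (Icc 0 1) x ≤ C

/-- Assumption (A4) on the law `Q` of the errors: all absolute moments are finite. -/
def AssumptionA4 (Q : Measure ℝ) : Prop :=
  ∀ q : ℕ, Integrable (fun e : ℝ => |e| ^ q) Q

/-- The first-stage sample size `n₁`: `⌊np⌋` or `⌊np⌋ + 1`, according to whether `n - ⌊np⌋` is even
or not. -/
def firstSize (p : ℝ) (n : ℕ) : ℕ :=
  if Even (n - ⌊(n : ℝ) * p⌋₊) then ⌊(n : ℝ) * p⌋₊ else ⌊(n : ℝ) * p⌋₊ + 1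

/-- The number `n₂` of second-stage observations at each of the two sampling points, so that
`n = n₁ + 2 n₂`. -/
def secondSize (p : ℝ) (n : ℕ) : ℕ := (n - firstSize p n) / 2

/-- `fhat` is an isotonic regression estimate on `[0,1]` from the data `(x i, Y i)`: it is
increasing on `[0,1]` and minimises the sum of squares among all such functions. -/
def IsIsotonicRegression {m : ℕ} (x Y : Fin m → ℝ) (fhat : ℝ → ℝ) : Prop :=
  MonotoneOn fhat (Icc 0 1) ∧
    ∀ h : ℝ → ℝ, MonotoneOn h (Icc 0 1) →
      ∑ i, (Y i - fhat (x i)) ^ 2 ≤ ∑ i, (Y i - h (x i)) ^ 2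

/-- The generalised inverse `inf {t ∈ [0,1] : fhat t ≥ θ}`. -/
def genInverse (fhat : ℝ → ℝ) (θ : ℝ) : ℝ := sInf {t | t ∈ Icc (0 : ℝ) 1 ∧ θ ≤ fhat t}

/-- The lower second-stage sampling point `d - K n₁ ^ (-γ)`. -/
def lowerPoint (K γ : ℝ) (n₁ : ℕ) (d : ℝ) : ℝ := d - K * (n₁ : ℝ) ^ (-γ)

/-- The upper second-stage sampling point `d + K n₁ ^ (-γ)`. -/
def upperPoint (K γ : ℝ) (n₁ : ℕ) (d : ℝ) : ℝ := d + K * (n₁ : ℝ) ^ (-γ)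

/-- `(b₀, b₁)` (intercept, slope) is a least squares fit of the linear model `y = b₀ + b₁ x` to the
data `(L, Y' i)`, `(U, Y'' i)`, `i < k`. -/
def IsLeastSquaresFit {k : ℕ} (L U : ℝ) (Y' Y'' : Fin k → ℝ) (b : ℝ × ℝ) : Prop :=
  ∀ c : ℝ × ℝ,
    ∑ i, ((Y' i - b.1 - b.2 * L) ^ 2 + (Y'' i - b.1 - b.2 * U) ^ 2) ≤
      ∑ i, ((Y' i - c.1 - c.2 * L) ^ 2 + (Y'' i - c.1 - c.2 * U) ^ 2)

/-- The bootstrap probability given the data: the law of the pair of index vectors of two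
independent samples of size `k`, each drawn with replacement from `k` items. -/
def bootstrapMeasure (k : ℕ) : Measure ((Fin k → Fin k) × (Fin k → Fin k)) :=
  (Measure.pi fun _ : Fin k => uniformOn (univ : Set (Fin k))).prod
    (Measure.pi fun _ : Fin k => uniformOn (univ : Set (Fin k)))

end TwoStage

end

namespace TwoStage

/-! With only two sampling points the least squares line passes through the two group means. The
slope is therefore `(f U - f L) / (U - L)` plus the difference of the two mean errors divided by `U
- L = 2K n₁^(-γ)`.

The difference quotient tends to `f'(d₀)` as soon as `L` and `U` tend to `d₀`, because continuity of
`f'` makes `f` strictly differentiable there. Thus `dhat` only has to be consistent; no rate is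
needed. Consistency (`tendsto_genInverse`) follows from bounds on block sums of an isotonic fit: if
the fit were on the wrong side of `f d₀` at a point away from `d₀`, the errors over some interval of
indices would sum to a positive fraction of `n₁`.

Rows with different `n` may depend on each other arbitrarily, so almost sure statements come from
moment bounds and Borel–Cantelli. The `k`-th moment of a sum of `N` errors is `O(N^(k/2))`; with
high moments the mean errors are `o(n₂^(-γ))` since `γ < 1/2`, and interval sums are uniformly
`o(n₁)`.

For the bootstrap, the difference quotient cancels in `βstar - βhat`, leaving resampled means minus
sample means. Chebyshev, with almost surely convergent empirical second moments, bounds the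
probability that these exceed a multiple of `n₁^(-γ)` by `O(n₂^(2γ - 1))`. -/

/-! ### Moments and tails of sums of independent centred variables -/

theorem AssumptionA4.memLp {Q : Measure ℝ} [IsProbabilityMeasure Q] (h : AssumptionA4 Q) (k : ℕ) :
    MemLp (fun e : ℝ => e) k Q := by
  rcases Nat.eq_zero_or_pos k with rfl | hk
  · simpa using (by fun_prop : AEStronglyMeasurable (fun e : ℝ => e) Q)
  · have hk0 : (k : ENNReal) ≠ 0 := by exact_mod_cast hk.ne'
    rw [← integrable_norm_rpow_iff (by fun_prop) hk0 (by simp)]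
    simpa using h k

theorem memLp_of_hasLaw {Ω : Type*} [MeasurableSpace Ω] {P : Measure Ω} {Q : Measure ℝ}
    {X : Ω → ℝ} (hX : HasLaw X Q P) {k : ENNReal} (hQ : MemLp (fun e : ℝ => e) k Q) :
    MemLp X k P := by
  have := hX.map_eq ▸ hQ
  exact this.comp_of_map hX.aemeasurable

theorem integrable_pow_of_memLp {Ω : Type*} [MeasurableSpace Ω] {P : Measure Ω}
    [IsFiniteMeasure P] {S : Ω → ℝ} {k : ℕ} (h : MemLp S k P) :
    Integrable (fun ω => S ω ^ k) P := by
  have := h.integrable_norm_pow'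
  refine this.mono' (h.1.pow k) ?_
  exact ae_of_all _ fun ω => by simp

theorem integral_add_pow_of_indepFun {Ω : Type*} [MeasurableSpace Ω] {P : Measure Ω}
    [IsProbabilityMeasure P] {S X : Ω → ℝ} (hSX : IndepFun S X P)
    (hS : ∀ k : ℕ, MemLp S k P) (hX : ∀ k : ℕ, MemLp X k P) (k : ℕ) :
    ∫ ω, (S ω + X ω) ^ k ∂P =
      ∑ j ∈ Finset.range (k + 1), (∫ ω, S ω ^ j ∂P) * (∫ ω, X ω ^ (k - j) ∂P) * (k.choose j) := by
  have hind : ∀ i j : ℕ, IndepFun (fun ω => S ω ^ i) (fun ω => X ω ^ j) P := fun i j =>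
    hSX.comp (φ := fun x => x ^ i) (ψ := fun x => x ^ j) (by fun_prop) (by fun_prop)
  simp_rw [add_pow]
  rw [integral_finsetSum]
  · refine Finset.sum_congr rfl fun j _ => ?_
    rw [integral_mul_const, (hind j (k - j)).integral_fun_mul_eq_mul_integral
      ((hS 1).1.pow j) ((hX 1).1.pow _)]
  · intro j _
    exact ((hind j (k - j)).integrable_mul (integrable_pow_of_memLp (hS j))
      (integrable_pow_of_memLp (hX _))).mul_const _

/-- The `k`-th moment of a sum of `N` independent centred variables with common law `Q` is
of order at most `N ^ (k / 2)`. -/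
theorem exists_abs_integral_sum_pow_le {Ω : Type*} [MeasurableSpace Ω] (P : Measure Ω)
    [IsProbabilityMeasure P] {Q : Measure ℝ} (hmean : ∫ e, e ∂Q = 0)
    (hmom : ∀ k : ℕ, MemLp (fun e : ℝ => e) k Q) (k : ℕ) :
    ∃ C : ℝ, 0 ≤ C ∧ ∀ (ι : Type) (X : ι → Ω → ℝ) (s : Finset ι), (∀ i, HasLaw (X i) Q P) →
      iIndepFun X P → |∫ ω, (∑ i ∈ s, X i ω) ^ k ∂P| ≤ C * √(s.card : ℝ) ^ k := by
  induction k using Nat.strong_induction_on with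
  | _ k ih =>
  match k, ih with
  | 0, _ => exact ⟨1, zero_le_one, fun ι X s _ _ => by simp⟩
  | 1, _ =>
    refine ⟨0, le_rfl, fun ι X s hX _ => ?_⟩
    simp only [pow_one]
    rw [integral_finsetSum]
    · simp [(hX _).integral_eq, hmean]
    · intro i _
      simpa using integrable_pow_of_memLp (memLp_of_hasLaw (hX i) (hmom 1))
  | l + 2, ih =>
    choose! c hc0 hc using ih
    -- In the binomial expansion after adding one variable, the term `j = l + 1` vanishes by
    -- centring and `j = l + 2` is the old moment; `D` collects the rest.
    set D : ℝ := ∑ j ∈ Finset.range (l + 1),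
      c j * |∫ e, e ^ (l + 2 - j) ∂Q| * ((l + 2).choose j) with hD
    have hD0 : 0 ≤ D := Finset.sum_nonneg fun j hj => by
      have := hc0 j (by have := Finset.mem_range.1 hj; omega)
      positivity
    refine ⟨D, hD0, fun ι X s hX hind => ?_⟩
    have hmX : ∀ i (k : ℕ), MemLp (X i) k P := fun i k => memLp_of_hasLaw (hX i) (hmom k)
    have hmS : ∀ (t : Finset ι) (k : ℕ), MemLp (fun ω => ∑ i ∈ t, X i ω) k P := fun t k =>
      memLp_finsetSum t fun i _ => hmX i k
    -- Each new variable raises the moment by at most `D * √N ^ l`. Keeping `N` fixed makes the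
    -- increments uniform; `N = s.card` then gives the claim.
    have key : ∀ N : ℕ, ∀ t : Finset ι, t.card ≤ N →
        |∫ ω, (∑ i ∈ t, X i ω) ^ (l + 2) ∂P| ≤ t.card * (D * √(N : ℝ) ^ l) := by
      classical
      intro N t
      induction t using Finset.induction_on with
      | empty => intro _; simp
      | insert a t ha iht =>
        intro hN
        rw [Finset.card_insert_of_notMem ha] at hN ⊢
        have h1 := iht (by omega)
        have hN1 : (1 : ℝ) ≤ √(N : ℝ) := by
          rw [Real.one_le_sqrt]; exact_mod_cast (by omega : 1 ≤ N)
        have hI : IndepFun (fun ω => ∑ i ∈ t, X i ω) (X a) P := by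
          have := hind.indepFun_finsetSum_of_notMem₀ (fun i => (hX i).aemeasurable) ha
          convert this using 1
          ext ω; simp
        have hmoment : ∀ j, ∫ ω, X a ω ^ j ∂P = ∫ e, e ^ j ∂Q := fun j =>
          (hX a).integral_comp (f := fun e => e ^ j) (by fun_prop)
        have h2 : ∫ ω, (∑ i ∈ insert a t, X i ω) ^ (l + 2) ∂P =
            (∑ j ∈ Finset.range (l + 1), (∫ ω, (∑ i ∈ t, X i ω) ^ j ∂P) *
              (∫ e, e ^ (l + 2 - j) ∂Q) * ((l + 2).choose j)) +
            ∫ ω, (∑ i ∈ t, X i ω) ^ (l + 2) ∂P := by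
          simp_rw [Finset.sum_insert ha, add_comm (X a _)]
          rw [integral_add_pow_of_indepFun hI (hmS t) (hmX a), Finset.sum_range_succ,
            Finset.sum_range_succ]
          have h0 : ∫ ω, X a ω ∂P = 0 := (hX a).integral_eq.trans hmean
          simp [hmoment, h0]
        have h3 : |∑ j ∈ Finset.range (l + 1), (∫ ω, (∑ i ∈ t, X i ω) ^ j ∂P) *
              (∫ e, e ^ (l + 2 - j) ∂Q) * ((l + 2).choose j)| ≤ D * √(N : ℝ) ^ l := by
          refine (Finset.abs_sum_le_sum_abs _ _).trans ?_
          rw [hD, Finset.sum_mul]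
          refine Finset.sum_le_sum fun j hj => ?_
          have hj' := Finset.mem_range.1 hj
          have h4 := hc j (by omega) ι X t hX hind
          have h5 : √(t.card : ℝ) ^ j ≤ √(N : ℝ) ^ l :=
            (pow_le_pow_left₀ (by positivity) (Real.sqrt_le_sqrt (by
              exact_mod_cast (by omega : t.card ≤ N))) j).trans
              (pow_le_pow_right₀ hN1 (by omega))
          have h6 : |∫ ω, (∑ i ∈ t, X i ω) ^ j ∂P| ≤ c j * √(N : ℝ) ^ l :=
            h4.trans (mul_le_mul_of_nonneg_left h5 (hc0 j (by omega)))
          rw [abs_mul, abs_mul, Nat.abs_cast]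
          calc _ ≤ (c j * √(N : ℝ) ^ l) * |∫ e, e ^ (l + 2 - j) ∂Q| * ((l + 2).choose j) := by
                gcongr
            _ = _ := by ring
        rw [h2]
        refine (abs_add_le _ _).trans ?_
        push_cast
        linarith
    refine (key s.card s le_rfl).trans (le_of_eq ?_)
    have : √(s.card : ℝ) ^ 2 = s.card := Real.sq_sqrt (by positivity)
    rw [pow_add, this]; ring

/-- Polynomial tail bound for a sum of independent centred variables with common law `Q`. -/
theorem exists_measure_abs_sum_ge_le {Ω : Type*} [MeasurableSpace Ω] (P : Measure Ω)
    [IsProbabilityMeasure P] {Q : Measure ℝ} (hmean : ∫ e, e ∂Q = 0)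
    (hmom : ∀ k : ℕ, MemLp (fun e : ℝ => e) k Q) (q : ℕ) :
    ∃ C : ℝ, 0 ≤ C ∧ ∀ (ι : Type) (X : ι → Ω → ℝ) (s : Finset ι), (∀ i, HasLaw (X i) Q P) →
      iIndepFun X P → ∀ a : ℝ, 0 < a →
      P {ω | a ≤ |∑ i ∈ s, X i ω|} ≤ ENNReal.ofReal (C * (s.card : ℝ) ^ q / a ^ (2 * q)) := by
  obtain ⟨C, hC0, hC⟩ := exists_abs_integral_sum_pow_le P hmean hmom (2 * q)
  refine ⟨C, hC0, fun ι X s hX hind a ha => ?_⟩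
  have h1 := hC ι X s hX hind
  have h0 : ∀ ω, 0 ≤ (∑ i ∈ s, X i ω) ^ (2 * q) := fun ω => by
    rw [pow_mul]; positivity
  have h2 := mul_meas_ge_le_integral_of_nonneg (μ := P)
    (f := fun ω => (∑ i ∈ s, X i ω) ^ (2 * q)) (ae_of_all _ h0)
    (integrable_pow_of_memLp (memLp_finsetSum s fun i _ => memLp_of_hasLaw (hX i) (hmom _)))
    (a ^ (2 * q))
  have h3 : {ω | a ≤ |∑ i ∈ s, X i ω|} ⊆ {ω | a ^ (2 * q) ≤ (∑ i ∈ s, X i ω) ^ (2 * q)} := by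
    intro ω hω
    have := pow_le_pow_left₀ ha.le hω (2 * q)
    simpa [pow_mul, sq_abs] using this
  refine (measure_mono h3).trans ?_
  rw [← ofReal_measureReal]
  refine ENNReal.ofReal_le_ofReal ?_
  rw [le_div_iff₀ (by positivity)]
  have h4 : √(s.card : ℝ) ^ (2 * q) = (s.card : ℝ) ^ q := by
    rw [pow_mul, Real.sq_sqrt (by positivity)]
  rw [h4] at h1
  have := (le_abs_self _).trans h1
  linarith

/-! ### Almost sure bounds for triangular arrays -/

/-- Borel–Cantelli for events whose probabilities are eventually at most `D / n ^ 2`. -/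
theorem ae_eventually_notMem_of_le {Ω : Type*} [MeasurableSpace Ω] {P : Measure Ω}
    [IsProbabilityMeasure P] {A : ℕ → Set Ω} (D : ℝ)
    (h : ∀ᶠ n : ℕ in atTop, P (A n) ≤ ENNReal.ofReal (D / (n : ℝ) ^ 2)) :
    ∀ᵐ ω ∂P, ∀ᶠ n in atTop, ω ∉ A n := by
  apply ae_eventually_notMem
  have hs : Summable fun n : ℕ => |D| / (n : ℝ) ^ 2 := by
    simpa [div_eq_mul_inv] using
      (Real.summable_nat_pow_inv.2 (by norm_num : 1 < 2)).mul_left |D|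
  have h2 : Summable fun n => P.real (A n) := by
    refine Summable.of_norm_bounded_eventually_nat hs ?_
    filter_upwards [h] with n hn
    rw [Real.norm_eq_abs, abs_of_nonneg measureReal_nonneg]
    refine ENNReal.toReal_le_of_le_ofReal (by positivity) (hn.trans (ENNReal.ofReal_le_ofReal ?_))
    gcongr; exact le_abs_self D
  have h3 : (∑' n, P (A n)) = ∑' n, ENNReal.ofReal (P.real (A n)) := by
    simp [ofReal_measureReal]
  rw [h3, ← ENNReal.ofReal_tsum_of_nonneg (fun _ => measureReal_nonneg) h2]
  exact ENNReal.ofReal_ne_top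

/-- The mean of the `n`-th row of a triangular array of centred variables, whose row lengths grow
at least linearly, is almost surely `o(m ^ (-a))` for every `a < 1 / 2`. -/
theorem ae_tendsto_rpow_mul_mean {Ω : Type*} [MeasurableSpace Ω] {P : Measure Ω}
    [IsProbabilityMeasure P] {Q : Measure ℝ} (hmean : ∫ e, e ∂Q = 0)
    (hmom : ∀ k : ℕ, MemLp (fun e : ℝ => e) k Q) {m : ℕ → ℕ} {c : ℝ} (hc : 0 < c)
    (hm : ∀ᶠ n : ℕ in atTop, c * n ≤ m n) {X : (n : ℕ) → Fin (m n) → Ω → ℝ}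
    (hX : ∀ n i, HasLaw (X n i) Q P) (hind : ∀ n, iIndepFun (X n) P) {a : ℝ} (ha : a < 1 / 2) :
    ∀ᵐ ω ∂P, Tendsto (fun n => (m n : ℝ) ^ a * ((∑ i, X n i ω) / m n)) atTop (𝓝 0) := by
  -- Markov's bound is of order `m^q / m^(2q(1 - a)) = m^(-q(1 - 2a))`; this `q` makes it at most
  -- `m^(-2)`.
  obtain ⟨q, hq⟩ := exists_nat_ge (2 / (1 - 2 * a))
  rw [div_le_iff₀ (by linarith)] at hq
  obtain ⟨C, hC0, hC⟩ := exists_measure_abs_sum_ge_le P hmean hmom q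
  -- Countably many thresholds `1 / (r + 1)`, so that one null set serves all `δ`.
  have main : ∀ r : ℕ, ∀ᵐ ω ∂P, ∀ᶠ n in atTop,
      ω ∉ {ω | 1 / ((r : ℝ) + 1) * (m n : ℝ) ^ (1 - a) ≤ |∑ i, X n i ω|} := by
    intro r
    apply ae_eventually_notMem_of_le (C * ((r : ℝ) + 1) ^ (2 * q) / c ^ 2)
    filter_upwards [hm, eventually_gt_atTop 0,
      (tendsto_natCast_atTop_atTop (R := ℝ)).eventually_ge_atTop (1 / c)] with n hn hn0 hn1
    have hn0' : (0 : ℝ) < n := by exact_mod_cast hn0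
    have hcn : 1 ≤ c * n := by rw [div_le_iff₀ hc] at hn1; linarith
    have hm0 : (0 : ℝ) < m n := by linarith
    refine (hC _ (X n) Finset.univ (hX n) (hind n) _ (by positivity)).trans
      (ENNReal.ofReal_le_ofReal ?_)
    rw [Finset.card_univ, Fintype.card_fin, mul_pow, div_pow, one_pow]
    have e1 : ((m n : ℝ) ^ (1 - a)) ^ (2 * q) = (m n : ℝ) ^ ((1 - a) * (2 * q : ℕ)) := by
      rw [Real.rpow_mul hm0.le, Real.rpow_natCast]
    have e2 : (m n : ℝ) ^ q * (m n : ℝ) ^ 2 ≤ (m n : ℝ) ^ ((1 - a) * (2 * q : ℕ)) := by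
      rw [← pow_add, ← Real.rpow_natCast]
      apply Real.rpow_le_rpow_of_exponent_le (by linarith)
      push_cast
      linarith
    rw [e1]
    have e3 : (c * n) ^ 2 ≤ (m n : ℝ) ^ 2 := by gcongr
    rw [div_div, ← mul_pow, div_le_div_iff₀ (by positivity) (by positivity)]
    calc C * (m n : ℝ) ^ q * (c * n) ^ 2 ≤ C * (m n : ℝ) ^ q * (m n : ℝ) ^ 2 := by gcongr
      _ = C * ((m n : ℝ) ^ q * (m n : ℝ) ^ 2) := by ring
      _ ≤ C * (m n : ℝ) ^ ((1 - a) * (2 * q : ℕ)) := by gcongr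
      _ = _ := by field_simp
  filter_upwards [ae_all_iff.2 main] with ω hω
  rw [Metric.tendsto_atTop']
  intro δ hδ
  obtain ⟨r, hr⟩ := exists_nat_one_div_lt hδ
  have := (hω r).and (hm.and ((eventually_gt_atTop 0)))
  obtain ⟨N, hN⟩ := eventually_atTop.1 this
  refine ⟨N, fun n hn => ?_⟩
  obtain ⟨h1, h2, h3⟩ := hN n hn.le
  have hn0 : (0 : ℝ) < n := by exact_mod_cast h3
  have hm0 : (0 : ℝ) < m n := lt_of_lt_of_le (by positivity) h2
  replace h1 := not_le.1 h1
  rw [Real.dist_eq, sub_zero, abs_mul, abs_div, Nat.abs_cast, abs_of_pos (by positivity)]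
  have e : (m n : ℝ) ^ (1 - a) = m n / (m n : ℝ) ^ a := by
    rw [Real.rpow_sub hm0, Real.rpow_one]
  rw [e] at h1
  refine lt_of_lt_of_le ?_ hr.le
  calc (m n : ℝ) ^ a * (|∑ i, X n i ω| / m n)
      < (m n : ℝ) ^ a * ((1 / ((r : ℝ) + 1) * (m n / (m n : ℝ) ^ a)) / m n) := by gcongr
    _ = _ := by field_simp

/-- In a triangular array of centred variables whose row lengths grow at least linearly, the sums
over all intervals of indices are almost surely uniformly of smaller order than the row length. -/
theorem ae_eventually_abs_sum_Icc_lt {Ω : Type*} [MeasurableSpace Ω] {P : Measure Ω}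
    [IsProbabilityMeasure P] {Q : Measure ℝ} (hmean : ∫ e, e ∂Q = 0)
    (hmom : ∀ k : ℕ, MemLp (fun e : ℝ => e) k Q) {m : ℕ → ℕ} {c : ℝ} (hc : 0 < c)
    (hm : ∀ᶠ n : ℕ in atTop, c * n ≤ m n) {X : (n : ℕ) → Fin (m n) → Ω → ℝ}
    (hX : ∀ n i, HasLaw (X n i) Q P) (hind : ∀ n, iIndepFun (X n) P) :
    ∀ᵐ ω ∂P, ∀ δ : ℝ, 0 < δ → ∀ᶠ n in atTop, ∀ j k : Fin (m n),
      |∑ i ∈ Finset.Icc j k, X n i ω| < δ * m n := by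
  -- Eighth moments: `m²` pairs of end points times `m⁴ / m⁸` leaves the summable `m^(-2)`.
  obtain ⟨C, hC0, hC⟩ := exists_measure_abs_sum_ge_le P hmean hmom 4
  have main : ∀ r : ℕ, ∀ᵐ ω ∂P, ∀ᶠ n in atTop,
      ω ∉ ⋃ jk : Fin (m n) × Fin (m n),
        {ω | 1 / ((r : ℝ) + 1) * m n ≤ |∑ i ∈ Finset.Icc jk.1 jk.2, X n i ω|} := by
    intro r
    apply ae_eventually_notMem_of_le (C * ((r : ℝ) + 1) ^ 8 / c ^ 2)
    filter_upwards [hm, eventually_gt_atTop 0] with n hn hn0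
    have hn0' : (0 : ℝ) < n := by exact_mod_cast hn0
    have hm0 : (0 : ℝ) < m n := lt_of_lt_of_le (by positivity) hn
    refine (measure_iUnion_fintype_le _ _).trans ?_
    have hb : ∀ jk : Fin (m n) × Fin (m n),
        P {ω | 1 / ((r : ℝ) + 1) * m n ≤ |∑ i ∈ Finset.Icc jk.1 jk.2, X n i ω|} ≤
          ENNReal.ofReal (C * (m n : ℝ) ^ 4 / (1 / ((r : ℝ) + 1) * m n) ^ 8) := by
      intro jk
      refine (hC _ (X n) _ (hX n) (hind n) _ (by positivity)).trans
        (ENNReal.ofReal_le_ofReal ?_)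
      have : ((Finset.Icc jk.1 jk.2).card : ℝ) ≤ m n := by
        exact_mod_cast (Finset.card_le_univ _).trans_eq (Fintype.card_fin _)
      gcongr
    refine (Finset.sum_le_sum fun jk _ => hb jk).trans ?_
    rw [Finset.sum_const, Finset.card_univ, Fintype.card_prod, Fintype.card_fin,
      ← ENNReal.ofReal_nsmul]
    refine ENNReal.ofReal_le_ofReal ?_
    have e3 : (c * n) ^ 2 ≤ (m n : ℝ) ^ 2 := by gcongr
    rw [nsmul_eq_mul, div_div, ← mul_pow]
    calc ((m n * m n : ℕ) : ℝ) * (C * (m n : ℝ) ^ 4 / (1 / ((r : ℝ) + 1) * m n) ^ 8)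
        = C * ((r : ℝ) + 1) ^ 8 / (m n : ℝ) ^ 2 := by push_cast; field_simp
      _ ≤ _ := by gcongr
  filter_upwards [ae_all_iff.2 main] with ω hω δ hδ
  obtain ⟨r, hr⟩ := exists_nat_one_div_lt hδ
  filter_upwards [hω r] with n hn j k
  simp only [mem_iUnion, mem_ofPred_eq, not_exists, not_le] at hn
  refine (hn (j, k)).trans_le ?_
  gcongr

/-! ### Block sums of the isotonic fit -/

/-- On a block of the form `{x ≥ a, fhat ≤ c}` the responses sum up to at most `c` times the size
of the block. -/
theorem IsIsotonicRegression.sum_filter_le {m : ℕ} {x Y : Fin m → ℝ} {fhat : ℝ → ℝ}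
    (h : IsIsotonicRegression x Y fhat) (a c : ℝ) :
    ∑ i with a ≤ x i ∧ fhat (x i) ≤ c, Y i ≤
      c * (Finset.univ.filter fun i => a ≤ x i ∧ fhat (x i) ≤ c).card := by
  set B := Finset.univ.filter fun i => a ≤ x i ∧ fhat (x i) ≤ c with hB
  obtain ⟨t₀, ht₀, hsep⟩ : ∃ t₀ : ℝ, 0 < t₀ ∧ ∀ i, c < fhat (x i) → c + t₀ ≤ fhat (x i) := by
    have : ∀ᶠ t : ℝ in 𝓝[>] 0, ∀ i, c < fhat (x i) → c + t ≤ fhat (x i) := by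
      rw [eventually_all]
      intro i
      by_cases hi : c < fhat (x i)
      · filter_upwards [Ioo_mem_nhdsGT (sub_pos.2 hi)] with t ht _
        linarith [ht.2]
      · exact Eventually.of_forall fun t h => absurd h hi
    obtain ⟨t, ht, ht'⟩ := (this.and self_mem_nhdsWithin).exists
    exact ⟨t, ht', ht⟩
  -- Compare with the competitor that lifts the fit by `t` on the block. The cap `c + t` keeps it
  -- monotone, and `t ≤ t₀` leaves fitted values above `c` untouched. Then `t → 0`.
  have key : ∀ t : ℝ, 0 < t → t ≤ t₀ → 2 * ∑ i ∈ B, (Y i - fhat (x i)) ≤ t * B.card := by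
    intro t ht htt
    have hmono : MonotoneOn
        (fun y => if a ≤ y then max (fhat y) (min (fhat y + t) (c + t)) else fhat y)
        (Icc 0 1) := by
      intro y hy z hz hyz
      have hf := h.1 hy hz hyz
      dsimp only
      by_cases h1 : a ≤ y
      · rw [if_pos h1, if_pos (h1.trans hyz)]
        gcongr
      · rw [if_neg h1]
        split_ifs
        · exact hf.trans (le_max_left _ _)
        · exact hf
    have h2 := h.2 _ hmono
    have h3 : ∀ i, (Y i - (if a ≤ x i then max (fhat (x i)) (min (fhat (x i) + t) (c + t))
        else fhat (x i))) ^ 2 =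
        (Y i - fhat (x i)) ^ 2 +
          if a ≤ x i ∧ fhat (x i) ≤ c then t ^ 2 - 2 * t * (Y i - fhat (x i)) else 0 := by
      intro i
      by_cases h1 : a ≤ x i
      · by_cases h4 : fhat (x i) ≤ c
        · rw [if_pos h1, if_pos ⟨h1, h4⟩, min_eq_left (by linarith), max_eq_right (by linarith)]
          ring
        · have := hsep i (not_le.1 h4)
          rw [if_pos h1, if_neg (fun h => h4 h.2), min_eq_right (by linarith),
            max_eq_left (by linarith)]
          ring
      · rw [if_neg h1, if_neg (fun h => h1 h.1)]; ring
    simp_rw [h3] at h2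
    rw [Finset.sum_add_distrib, ← Finset.sum_filter, ← hB, Finset.sum_sub_distrib,
      ← Finset.mul_sum, Finset.sum_const, nsmul_eq_mul] at h2
    have h5 : t * (2 * ∑ i ∈ B, (Y i - fhat (x i))) ≤ t * (t * B.card) := by linarith
    exact le_of_mul_le_mul_left h5 ht
  have hle : ∑ i ∈ B, (Y i - fhat (x i)) ≤ 0 := by
    have hlim : Tendsto (fun t : ℝ => t * (B.card : ℝ)) (𝓝[>] 0) (𝓝 0) := by
      have : Tendsto (fun t : ℝ => t * (B.card : ℝ)) (𝓝 0) (𝓝 (0 * B.card)) :=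
        tendsto_id.mul_const _
      rw [zero_mul] at this
      exact this.mono_left nhdsWithin_le_nhds
    have h1 : 2 * ∑ i ∈ B, (Y i - fhat (x i)) ≤ 0 := by
      refine ge_of_tendsto hlim ?_
      filter_upwards [Ioc_mem_nhdsGT ht₀] with t ht using key t ht.1 ht.2
    linarith
  have hfc : ∑ i ∈ B, fhat (x i) ≤ c * B.card := by
    rw [mul_comm, ← nsmul_eq_mul]
    exact Finset.sum_le_card_nsmul _ _ _ fun i hi => (Finset.mem_filter.1 hi).2.2
  rw [Finset.sum_sub_distrib] at hle
  linarith

/-- Reversing both axes preserves monotonicity and squared residuals; this converts upper bounds on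
block sums into lower ones. -/
theorem IsIsotonicRegression.reflect {m : ℕ} {x Y : Fin m → ℝ} {fhat : ℝ → ℝ}
    (h : IsIsotonicRegression x Y fhat) :
    IsIsotonicRegression (fun i => 1 - x i) (fun i => -Y i) (fun t => -fhat (1 - t)) := by
  have hrefl : ∀ g : ℝ → ℝ, MonotoneOn g (Icc 0 1) →
      MonotoneOn (fun t => -g (1 - t)) (Icc 0 1) := fun g hg y hy z hz hyz =>
    neg_le_neg (hg ⟨by linarith [hz.2], by linarith [hz.1]⟩
      ⟨by linarith [hy.2], by linarith [hy.1]⟩ (by linarith))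
  refine ⟨hrefl _ h.1, fun g hg => ?_⟩
  have := h.2 _ (hrefl g hg)
  convert this using 2 with i _ i _
  · simp only [sub_sub_cancel]; ring
  · ring

/-- On a block of the form `{x ≤ a, c ≤ fhat}` the responses sum up to at least `c` times the size
of the block. -/
theorem IsIsotonicRegression.le_sum_filter {m : ℕ} {x Y : Fin m → ℝ} {fhat : ℝ → ℝ}
    (h : IsIsotonicRegression x Y fhat) (a c : ℝ) :
    c * (Finset.univ.filter fun i => x i ≤ a ∧ c ≤ fhat (x i)).card ≤
      ∑ i with x i ≤ a ∧ c ≤ fhat (x i), Y i := by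
  have := h.reflect.sum_filter_le (1 - a) (-c)
  simp only [sub_sub_cancel, sub_le_sub_iff_left, neg_le_neg_iff, Finset.sum_neg_distrib] at this
  linarith

/-- Error sums are controlled over index intervals only, so blocks must be recognised as such. -/
theorem eq_Icc_of_ordConnected {m : ℕ} {B : Finset (Fin m)} (hB : (B : Set (Fin m)).OrdConnected)
    (hne : B.Nonempty) : B = Finset.Icc (B.min' hne) (B.max' hne) := by
  ext i
  rw [Finset.mem_Icc]
  exact ⟨fun hi => ⟨B.min'_le i hi, B.le_max' i hi⟩,
    fun hi => hB.out (B.min'_mem hne) (B.max'_mem hne) hi⟩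

/-- If the errors are small and the regression function clearly exceeds the level `θ` at a
substantial number of design points between `d` and `b`, then the isotonic estimate exceeds `θ`
at `b`. -/
theorem IsIsotonicRegression.lt_apply_of_abs_sum_lt {m : ℕ} {x e : Fin m → ℝ} {f fhat : ℝ → ℝ}
    (hx : StrictMono x) (hx01 : ∀ i, x i ∈ Icc (0 : ℝ) 1)
    (h : IsIsotonicRegression x (fun i => f (x i) + e i) fhat)
    {d b' b θ s κ : ℝ} (hbI : b ∈ Icc (0 : ℝ) 1) (hs : 0 < s) (hdb : d ≤ b')
    (hf : ∀ i, d ≤ x i → θ ≤ f (x i)) (hfs : ∀ i, b' < x i → θ + s ≤ f (x i))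
    (hκ : 0 < κ * m)
    (hcount : κ * m ≤ (Finset.univ.filter fun i => b' < x i ∧ x i ≤ b).card)
    (he : ∀ j k : Fin m, |∑ i ∈ Finset.Icc j k, e i| < s * κ * m) :
    θ < fhat b := by
  -- Otherwise the block `B` contains every design point of `(b', b]`. Its responses sum to at most
  -- `θ |B|`, while `f` contributes at least `θ |B| + s κ m`, forcing an error sum of at most `-s κ
  -- m`.
  by_contra! hcon
  set B := Finset.univ.filter fun i => d ≤ x i ∧ fhat (x i) ≤ θ with hB
  set B₁ := Finset.univ.filter fun i => b' < x i ∧ x i ≤ b with hB₁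
  have hsub : B₁ ⊆ B := by
    intro i hi
    simp only [hB₁, hB, Finset.mem_filter, Finset.mem_univ, true_and] at hi ⊢
    exact ⟨by linarith [hi.1], (h.1 (hx01 i) hbI hi.2).trans hcon⟩
  have hne : B.Nonempty := by
    refine Finset.Nonempty.mono hsub (Finset.card_pos.1 ?_)
    exact_mod_cast hκ.trans_le hcount
  have hord : (B : Set (Fin m)).OrdConnected := by
    refine ⟨fun i hi k hk j hj => ?_⟩
    simp only [hB, Finset.coe_filter, Finset.mem_univ, true_and, mem_ofPred_eq] at hi hk ⊢
    exact ⟨hi.1.trans (hx.monotone hj.1), (h.1 (hx01 j) (hx01 k) (hx.monotone hj.2)).trans hk.2⟩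
  have h1 := h.sum_filter_le d θ
  rw [← hB, Finset.sum_add_distrib] at h1
  have h2 := he (B.min' hne) (B.max' hne)
  rw [← eq_Icc_of_ordConnected hord hne] at h2
  have h3 : θ * B.card + s * B₁.card ≤ ∑ i ∈ B, f (x i) := by
    have e1 : s * (B₁.card : ℝ) = ∑ i ∈ B, if i ∈ B₁ then s else 0 := by
      rw [← Finset.sum_filter, Finset.filter_mem_eq_inter, Finset.inter_eq_right.2 hsub,
        Finset.sum_const, nsmul_eq_mul, mul_comm]
    have e2 : θ * (B.card : ℝ) = ∑ i ∈ B, θ := by rw [Finset.sum_const, nsmul_eq_mul, mul_comm]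
    rw [e1, e2, ← Finset.sum_add_distrib]
    refine Finset.sum_le_sum fun i hi => ?_
    split_ifs with hi1
    · exact hfs i (Finset.mem_filter.1 hi1).2.1
    · rw [add_zero]; exact hf i (Finset.mem_filter.1 hi).2.1
  have h4 : s * (κ * m) ≤ s * B₁.card := by gcongr
  linarith [(abs_lt.1 h2).1]

/-- The counterpart of `IsIsotonicRegression.lt_apply_of_abs_sum_lt` to the left of `d`. -/
theorem IsIsotonicRegression.apply_lt_of_abs_sum_lt {m : ℕ} {x e : Fin m → ℝ} {f fhat : ℝ → ℝ}
    (hx : StrictMono x) (hx01 : ∀ i, x i ∈ Icc (0 : ℝ) 1)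
    (h : IsIsotonicRegression x (fun i => f (x i) + e i) fhat)
    {d b' b θ s κ : ℝ} (hbI : b ∈ Icc (0 : ℝ) 1) (hs : 0 < s) (hdb : b' ≤ d)
    (hf : ∀ i, x i ≤ d → f (x i) ≤ θ) (hfs : ∀ i, x i ≤ b' → f (x i) + s ≤ θ)
    (hκ : 0 < κ * m)
    (hcount : κ * m ≤ (Finset.univ.filter fun i => b < x i ∧ x i ≤ b').card)
    (he : ∀ j k : Fin m, |∑ i ∈ Finset.Icc j k, e i| < s * κ * m) :
    fhat b < θ := by
  by_contra! hcon
  set B := Finset.univ.filter fun i => x i ≤ d ∧ θ ≤ fhat (x i) with hB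
  set B₁ := Finset.univ.filter fun i => b < x i ∧ x i ≤ b' with hB₁
  have hsub : B₁ ⊆ B := by
    intro i hi
    simp only [hB₁, hB, Finset.mem_filter, Finset.mem_univ, true_and] at hi ⊢
    exact ⟨by linarith [hi.2], hcon.trans (h.1 hbI (hx01 i) hi.1.le)⟩
  have hne : B.Nonempty := by
    refine Finset.Nonempty.mono hsub (Finset.card_pos.1 ?_)
    exact_mod_cast hκ.trans_le hcount
  have hord : (B : Set (Fin m)).OrdConnected := by
    refine ⟨fun i hi k hk j hj => ?_⟩
    simp only [hB, Finset.coe_filter, Finset.mem_univ, true_and, mem_ofPred_eq] at hi hk ⊢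
    exact ⟨(hx.monotone hj.2).trans hk.1, hi.2.trans (h.1 (hx01 i) (hx01 j) (hx.monotone hj.1))⟩
  have h1 := h.le_sum_filter d θ
  rw [← hB, Finset.sum_add_distrib] at h1
  have h2 := he (B.min' hne) (B.max' hne)
  rw [← eq_Icc_of_ordConnected hord hne] at h2
  have h3 : ∑ i ∈ B, f (x i) ≤ θ * B.card - s * B₁.card := by
    have e1 : s * (B₁.card : ℝ) = ∑ i ∈ B, if i ∈ B₁ then s else 0 := by
      rw [← Finset.sum_filter, Finset.filter_mem_eq_inter, Finset.inter_eq_right.2 hsub,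
        Finset.sum_const, nsmul_eq_mul, mul_comm]
    have e2 : θ * (B.card : ℝ) = ∑ i ∈ B, θ := by rw [Finset.sum_const, nsmul_eq_mul, mul_comm]
    rw [e1, e2, ← Finset.sum_sub_distrib]
    refine Finset.sum_le_sum fun i hi => ?_
    split_ifs with hi1
    · linarith [hfs i (Finset.mem_filter.1 hi1).2.2]
    · rw [sub_zero]; exact hf i (Finset.mem_filter.1 hi).2.1
  have h4 : s * (κ * m) ≤ s * B₁.card := by gcongr
  linarith [(abs_lt.1 h2).2]

/-! ### Consistency of the first-stage estimate -/

/-- Under (A2), a nondegenerate subinterval of `[0,1]` contains asymptotically a positive fraction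
of the design points. -/
theorem AssumptionA2.exists_le_card_filter {x : (m : ℕ) → Fin m → ℝ} (hA2 : AssumptionA2 x)
    {a b : ℝ} (ha : 0 ≤ a) (hab : a < b) (hb : b ≤ 1) :
    ∃ κ : ℝ, 0 < κ ∧ ∀ᶠ m : ℕ in atTop,
      κ * m ≤ (Finset.univ.filter fun i : Fin m => a < x m i ∧ x m i ≤ b).card := by
  obtain ⟨ν, g, hν, hgm, -, hνg, hg, -, -, C, hC⟩ := hA2
  have hpos : 0 < ν (Ioc a b) := by
    rw [hνg, withDensity_apply _ measurableSet_Ioc]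
    rw [setLIntegral_pos_iff (by fun_prop)]
    have : Ioc a b ⊆ (Function.support fun t => ENNReal.ofReal (g t)) ∩ Ioc a b := by
      refine fun t ht => ⟨?_, ht⟩
      have := hg t ⟨by linarith [ht.1], by linarith [ht.2]⟩
      simpa using this
    refine lt_of_lt_of_le ?_ (measure_mono this)
    simpa using hab
  have hcdf : ν.real (Ioc a b) = cdf ν b - cdf ν a := by
    rw [cdf_eq_real, cdf_eq_real, ← measureReal_sdiff (Iic_subset_Iic.2 hab.le) measurableSet_Iic]
    congr 1
    ext t
    simp [and_comm]
  set w := ν.real (Ioc a b) with hw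
  have hw0 : 0 < w := ENNReal.toReal_pos hpos.ne' (measure_ne_top _ _)
  -- Half the mass of `(a, b]`; the other half absorbs the approximation errors at the two end
  -- points.
  refine ⟨w / 2, by positivity, ?_⟩
  have hlim : Tendsto (fun m : ℕ => 2 * (C * (m : ℝ) ^ (-(1 / 2) : ℝ))) atTop (𝓝 0) := by
    have := ((tendsto_rpow_neg_atTop (by norm_num : (0 : ℝ) < 1 / 2)).comp
      (tendsto_natCast_atTop_atTop (R := ℝ))).const_mul C |>.const_mul 2
    simpa using this
  filter_upwards [hlim.eventually_lt_const (by positivity : 0 < w / 2), eventually_gt_atTop 0]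
    with m hm hm0
  have hm0' : (0 : ℝ) < m := by exact_mod_cast hm0
  have h1 := abs_le.1 (hC m hm0 a ⟨ha, by linarith⟩)
  have h2 := abs_le.1 (hC m hm0 b ⟨by linarith, hb⟩)
  have h3 : w / 2 ≤ empiricalCDF (x m) b - empiricalCDF (x m) a := by
    linarith [h1.2, h2.1]
  have h4 : ((Finset.univ.filter fun i : Fin m => a < x m i ∧ x m i ≤ b).card : ℝ) +
      (Finset.univ.filter fun i : Fin m => x m i ≤ a).card =
      (Finset.univ.filter fun i : Fin m => x m i ≤ b).card := by
    rw [← Nat.cast_add, ← Finset.card_union_of_disjoint]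
    · congr 2
      ext i
      simp only [Finset.mem_union, Finset.mem_filter, Finset.mem_univ, true_and]
      constructor
      · rintro (h | h)
        · exact h.2
        · linarith
      · intro h
        rcases lt_or_ge a (x m i) with h' | h'
        · exact Or.inl ⟨h', h⟩
        · exact Or.inr h'
    · rw [Finset.disjoint_filter]
      intro i _ h h'
      linarith [h.1]
  rw [empiricalCDF, empiricalCDF, ← sub_div, le_div_iff₀ hm0'] at h3
  linarith

/-- Monotonicity excludes points below `a`, and `b` itself is admissible, so the infimum is over a
nonempty set and not a default value. -/
theorem genInverse_mem_Icc {fhat : ℝ → ℝ} (hmono : MonotoneOn fhat (Icc 0 1)) {θ a b : ℝ}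
    (ha : a ∈ Icc (0 : ℝ) 1) (hb : b ∈ Icc (0 : ℝ) 1) (hfa : fhat a < θ) (hfb : θ ≤ fhat b) :
    genInverse fhat θ ∈ Icc a b := by
  refine ⟨le_csInf ⟨b, hb, hfb⟩ fun t ht => ?_, csInf_le ⟨0, fun t ht => ht.1.1⟩ ⟨hb, hfb⟩⟩
  by_contra! h
  exact absurd (hmono ht.1 ha h.le) (not_le.2 (hfa.trans_le ht.2))

/-- Consistency of the generalised inverse of the isotonic regression estimate, for a fixed
realisation of the errors. -/
theorem tendsto_genInverse {x : (m : ℕ) → Fin m → ℝ} (hx : IsDesignArray x)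
    (hA2 : AssumptionA2 x) {f : ℝ → ℝ} (hf : StrictMonoOn f (Icc 0 1)) {d₀ : ℝ}
    (hd₀ : d₀ ∈ Ioo (0 : ℝ) 1) {m : ℕ → ℕ} (hm : Tendsto m atTop atTop)
    {e : (n : ℕ) → Fin (m n) → ℝ}
    (he : ∀ δ : ℝ, 0 < δ → ∀ᶠ n in atTop, ∀ j k : Fin (m n),
      |∑ i ∈ Finset.Icc j k, e n i| < δ * m n)
    {fhat : ℕ → ℝ → ℝ}
    (hfhat : ∀ n, IsIsotonicRegression (x (m n)) (fun i => f (x (m n) i) + e n i) (fhat n)) :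
    Tendsto (fun n => genInverse (fhat n) (f d₀)) atTop (𝓝 d₀) := by
  have hd₀' : d₀ ∈ Icc (0 : ℝ) 1 := Ioo_subset_Icc_self hd₀
  have hup : ∀ b, d₀ < b → b ≤ 1 → ∀ᶠ n in atTop, f d₀ < fhat n b := by
    intro b hb hb1
    have hbI : b ∈ Icc (0 : ℝ) 1 := ⟨by linarith [hd₀.1], hb1⟩
    -- Beyond the midpoint `f` exceeds `f d₀` by a fixed gap, and a positive fraction of the design
    -- lies between the midpoint and `b`.
    have hcI : (d₀ + b) / 2 ∈ Icc (0 : ℝ) 1 := ⟨by linarith [hd₀.1], by linarith [hd₀.2]⟩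
    obtain ⟨κ, hκ, hcount⟩ := hA2.exists_le_card_filter hcI.1
      (by linarith : (d₀ + b) / 2 < b) hb1
    have hs : 0 < f ((d₀ + b) / 2) - f d₀ := sub_pos.2 (hf hd₀' hcI (by linarith))
    filter_upwards [hm.eventually hcount, he _ (mul_pos hs hκ),
      hm.eventually (eventually_gt_atTop 0)] with n h1 h2 h3
    have h3' : (0 : ℝ) < m n := by exact_mod_cast h3
    refine (hfhat n).lt_apply_of_abs_sum_lt (hx _).1 (hx _).2 hbI hs
      (by linarith : d₀ ≤ (d₀ + b) / 2)
      (fun i hi => hf.monotoneOn hd₀' ((hx _).2 i) hi)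
      (fun i hi => ?_) (by positivity) h1 h2
    linarith [hf.monotoneOn hcI ((hx _).2 i) hi.le]
  have hlow : ∀ a, a < d₀ → 0 ≤ a → ∀ᶠ n in atTop, fhat n a < f d₀ := by
    intro a ha ha0
    have haI : a ∈ Icc (0 : ℝ) 1 := ⟨ha0, by linarith [hd₀.2]⟩
    have hcI : (a + d₀) / 2 ∈ Icc (0 : ℝ) 1 := ⟨by linarith [hd₀.1], by linarith [hd₀.2]⟩
    obtain ⟨κ, hκ, hcount⟩ := hA2.exists_le_card_filter ha0
      (by linarith : a < (a + d₀) / 2) hcI.2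
    have hs : 0 < f d₀ - f ((a + d₀) / 2) := sub_pos.2 (hf hcI hd₀' (by linarith))
    filter_upwards [hm.eventually hcount, he _ (mul_pos hs hκ),
      hm.eventually (eventually_gt_atTop 0)] with n h1 h2 h3
    have h3' : (0 : ℝ) < m n := by exact_mod_cast h3
    refine (hfhat n).apply_lt_of_abs_sum_lt (hx _).1 (hx _).2 haI hs
      (by linarith : (a + d₀) / 2 ≤ d₀)
      (fun i hi => hf.monotoneOn ((hx _).2 i) hd₀' hi)
      (fun i hi => ?_) (by positivity) h1 h2
    linarith [hf.monotoneOn ((hx _).2 i) hcI hi]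
  refine tendsto_order.2 ⟨fun a ha => ?_, fun b hb => ?_⟩
  · have h1 : max a 0 < d₀ := max_lt ha hd₀.1
    filter_upwards [hup 1 hd₀.2 le_rfl, hlow ((max a 0 + d₀) / 2) (by linarith)
      (by linarith [le_max_right a 0, hd₀.1])] with n h2 h3
    have := (genInverse_mem_Icc (hfhat n).1
      ⟨by linarith [le_max_right a 0, hd₀.1], by linarith [hd₀.2]⟩
      (right_mem_Icc.2 zero_le_one) h3 h2.le).1
    linarith [le_max_left a 0]
  · have h1 : d₀ < min b 1 := lt_min hb hd₀.2
    filter_upwards [hlow 0 hd₀.1 le_rfl, hup ((min b 1 + d₀) / 2) (by linarith)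
      (by linarith [min_le_right b 1, hd₀.2])] with n h2 h3
    have := (genInverse_mem_Icc (hfhat n).1 (left_mem_Icc.2 zero_le_one)
      ⟨by linarith [hd₀.1], by linarith [min_le_right b 1, hd₀.2]⟩ h2 h3.le).2
    linarith [min_le_left b 1]

theorem AssumptionA3.strictMonoOn {f : ℝ → ℝ} (h : AssumptionA3 f) :
    StrictMonoOn f (Icc 0 1) := by
  obtain ⟨hd, c, C, hc, hcC⟩ := h
  refine strictMonoOn_of_deriv_pos (convex_Icc 0 1) hd.continuousOn fun t ht => ?_
  have ht' : t ∈ Icc (0 : ℝ) 1 := interior_subset ht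
  rw [← derivWithin_of_mem_nhds (mem_interior_iff_mem_nhds.1 ht)]
  exact hc.trans_le (hcC t ht').1

/-! ### Least squares at two sampling points -/

theorem sum_sub_sq_eq {k : ℕ} (hk : 0 < k) (Y : Fin k → ℝ) (a : ℝ) :
    ∑ i, (Y i - a) ^ 2 = ∑ i, (Y i - (∑ i, Y i) / k) ^ 2 + k * ((∑ i, Y i) / k - a) ^ 2 := by
  have hk' : (k : ℝ) ≠ 0 := by exact_mod_cast hk.ne'
  have hS : ∑ i, Y i = k * ((∑ i, Y i) / k) := by field_simp
  set M := (∑ i, Y i) / k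
  have h : ∀ i, (Y i - a) ^ 2 = (Y i - M) ^ 2 + (2 * (M - a) * Y i + (a ^ 2 - M ^ 2)) := fun i => by
    ring
  simp_rw [h]
  rw [Finset.sum_add_distrib, Finset.sum_add_distrib, ← Finset.mul_sum, hS, Finset.sum_const,
    Finset.card_univ, Fintype.card_fin, nsmul_eq_mul]
  ring

theorem IsLeastSquaresFit.snd_eq {k : ℕ} (hk : 0 < k) {L U : ℝ} (hLU : L ≠ U)
    {Y' Y'' : Fin k → ℝ} {b : ℝ × ℝ} (h : IsLeastSquaresFit L U Y' Y'' b) :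
    b.2 = ((∑ i, Y'' i) / k - (∑ i, Y' i) / k) / (U - L) := by
  have hk' : (0 : ℝ) < k := by exact_mod_cast hk
  have hUL : U - L ≠ 0 := sub_ne_zero.2 hLU.symm
  set M' := (∑ i, Y' i) / k with hM'
  set M'' := (∑ i, Y'' i) / k with hM''
  -- The competitor is the line through both group means; it annihilates both bias terms, so the
  -- minimiser must do so too.
  have h1 := h (M' - (M'' - M') / (U - L) * L, (M'' - M') / (U - L))
  have e1 : M' - (M'' - M') / (U - L) * L + (M'' - M') / (U - L) * U = M'' := by
    field_simp; ring
  have hg : ∀ c : ℝ × ℝ, ∑ i, ((Y' i - c.1 - c.2 * L) ^ 2 + (Y'' i - c.1 - c.2 * U) ^ 2) =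
      (∑ i, (Y' i - M') ^ 2 + k * (M' - (c.1 + c.2 * L)) ^ 2) +
      (∑ i, (Y'' i - M'') ^ 2 + k * (M'' - (c.1 + c.2 * U)) ^ 2) := fun c => by
    rw [← sum_sub_sq_eq hk, ← sum_sub_sq_eq hk, ← Finset.sum_add_distrib]
    simp_rw [sub_sub]
  rw [hg, hg] at h1
  simp only [e1, sub_add_cancel, sub_self] at h1
  have h2 : (k : ℝ) * ((M' - (b.1 + b.2 * L)) ^ 2 + (M'' - (b.1 + b.2 * U)) ^ 2) ≤ 0 := by
    linarith
  have h3 := nonpos_of_mul_nonpos_right h2 hk'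
  have h4 : M' - (b.1 + b.2 * L) = 0 := by
    refine pow_eq_zero_iff two_ne_zero |>.1 (le_antisymm ?_ (sq_nonneg _))
    linarith [sq_nonneg (M'' - (b.1 + b.2 * U))]
  have h5 : M'' - (b.1 + b.2 * U) = 0 := by
    refine pow_eq_zero_iff two_ne_zero |>.1 (le_antisymm ?_ (sq_nonneg _))
    linarith [sq_nonneg (M' - (b.1 + b.2 * L))]
  rw [eq_div_iff hUL]
  linarith

/-- The error vectors are arbitrary, so this serves the original fit and, with resampled errors, the
bootstrap fit. -/
theorem IsLeastSquaresFit.snd_eq_add {k : ℕ} (hk : 0 < k) {L U u v : ℝ} (hLU : L ≠ U)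
    {e' e'' : Fin k → ℝ} {b : ℝ × ℝ}
    (h : IsLeastSquaresFit L U (fun i => u + e' i) (fun i => v + e'' i) b) :
    b.2 = (v - u) / (U - L) + ((∑ i, e'' i) / k - (∑ i, e' i) / k) / (U - L) := by
  have hk' : (k : ℝ) ≠ 0 := by exact_mod_cast hk.ne'
  rw [h.snd_eq hk hLU, ← add_div]
  congr 1
  simp only [Finset.sum_add_distrib, Finset.sum_const, Finset.card_univ, Fintype.card_fin,
    nsmul_eq_mul]
  field_simp
  ring

/-! ### Sampling with replacement -/

theorem integral_uniformOn_univ {k : ℕ} (g : Fin k → ℝ) :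
    ∫ j, g j ∂(uniformOn (univ : Set (Fin k))) = (∑ j, g j) / k := by
  rcases Nat.eq_zero_or_pos k with rfl | hk
  · simp [integral_fintype]
  have : Nonempty (Fin k) := ⟨⟨0, hk⟩⟩
  have : IsProbabilityMeasure (uniformOn (univ : Set (Fin k))) :=
    isProbabilityMeasure_uniformOn finite_univ univ_nonempty
  rw [integral_fintype .of_finite, Finset.sum_div]
  refine Finset.sum_congr rfl fun j _ => ?_
  rw [measureReal_def, uniformOn_univ]
  simp [div_eq_inv_mul]

/-- Chebyshev's inequality for the mean of a sample with replacement. -/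
theorem pi_uniformOn_abs_sub_mean_ge_le {k : ℕ} (hk : 0 < k) (e : Fin k → ℝ) {η : ℝ} (hη : 0 < η) :
    (Measure.pi fun _ : Fin k => uniformOn (univ : Set (Fin k)))
      {r | η ≤ |(∑ i, e (r i)) / k - (∑ i, e i) / k|} ≤
      ENNReal.ofReal ((∑ i, e i ^ 2) / (k * η) ^ 2) := by
  have : Nonempty (Fin k) := ⟨⟨0, hk⟩⟩
  have hk' : (0 : ℝ) < k := by exact_mod_cast hk
  have : IsProbabilityMeasure (uniformOn (univ : Set (Fin k))) :=
    isProbabilityMeasure_uniformOn finite_univ univ_nonempty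
  set μ := uniformOn (univ : Set (Fin k)) with hμ
  have hmem : ∀ g : Fin k → ℝ, MemLp g 2 μ := fun g => MemLp.of_discrete
  have hX : MemLp (∑ i, fun r : Fin k → Fin k => e (r i)) 2 (Measure.pi fun _ : Fin k => μ) :=
    MemLp.of_discrete
  have hcheb := meas_ge_le_variance_div_sq hX (mul_pos hk' hη)
  have hint : ∫ r, (∑ i, fun r : Fin k → Fin k => e (r i)) r ∂(Measure.pi fun _ : Fin k => μ) =
      ∑ i, e i := by
    simp only [Finset.sum_apply]
    rw [integral_finsetSum _ fun i _ => Integrable.of_finite]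
    have : ∀ i : Fin k, ∫ r, e (r i) ∂(Measure.pi fun _ : Fin k => μ) = (∑ i, e i) / k := by
      intro i
      rw [← integral_uniformOn_univ]
      have hmp := measurePreserving_eval (fun _ : Fin k => μ) i
      have hmap := integral_map (μ := Measure.pi fun _ : Fin k => μ) (f := e)
        hmp.measurable.aemeasurable (by fun_prop)
      rw [hmp.map_eq] at hmap
      exact hmap.symm
    simp_rw [this]
    rw [Finset.sum_const, Finset.card_univ, Fintype.card_fin, nsmul_eq_mul]
    field_simp
  have hvar : Var[∑ i, fun r : Fin k → Fin k => e (r i); Measure.pi fun _ : Fin k => μ] ≤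
      ∑ i, e i ^ 2 := by
    rw [variance_sum_pi (X := fun _ => e) fun _ => hmem e, Finset.sum_const, Finset.card_univ,
      Fintype.card_fin, nsmul_eq_mul]
    have h1 : Var[e; μ] ≤ (∑ i, e i ^ 2) / k := by
      rw [← integral_uniformOn_univ]
      exact variance_le_expectation_sq (by fun_prop)
    calc (k : ℝ) * Var[e; μ] ≤ k * ((∑ i, e i ^ 2) / k) := by gcongr
      _ = _ := by field_simp
  refine le_trans (measure_mono ?_) (hcheb.trans (ENNReal.ofReal_le_ofReal (by gcongr)))
  intro r hr
  rw [mem_ofPred_eq] at hr ⊢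
  rw [hint, Finset.sum_apply]
  rw [← sub_div, abs_div, Nat.abs_cast, le_div_iff₀ hk'] at hr
  linarith

/-- A large bootstrap deviation needs one of the two resampled means to deviate; a union bound
reduces it to the marginals. -/
theorem bootstrapMeasure_union_le {k : ℕ} (hk : 0 < k) (A B : Set (Fin k → Fin k)) :
    bootstrapMeasure k {rs | rs.1 ∈ A ∨ rs.2 ∈ B} ≤
      (Measure.pi fun _ : Fin k => uniformOn (univ : Set (Fin k))) A +
      (Measure.pi fun _ : Fin k => uniformOn (univ : Set (Fin k))) B := by
  have : Nonempty (Fin k) := ⟨⟨0, hk⟩⟩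
  have : IsProbabilityMeasure (uniformOn (univ : Set (Fin k))) :=
    isProbabilityMeasure_uniformOn finite_univ univ_nonempty
  have h : {rs : (Fin k → Fin k) × (Fin k → Fin k) | rs.1 ∈ A ∨ rs.2 ∈ B} =
      A ×ˢ univ ∪ univ ×ˢ B := by
    ext; simp
  rw [h]
  refine (measure_union_le _ _).trans ?_
  rw [bootstrapMeasure, Measure.prod_prod, Measure.prod_prod]
  simp

/-! ### Difference quotients and stage sizes -/

/-- Difference quotients over intervals that shrink to a point of continuity of the derivative. -/
theorem tendsto_slope_of_tendsto {f : ℝ → ℝ} {d : ℝ}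
    (hf : ∀ᶠ x in 𝓝 d, DifferentiableAt ℝ f x) (hc : ContinuousAt (deriv f) d) {L U : ℕ → ℝ}
    (hL : Tendsto L atTop (𝓝 d)) (hU : Tendsto U atTop (𝓝 d)) (hLU : ∀ᶠ n in atTop, L n ≠ U n) :
    Tendsto (fun n => (f (U n) - f (L n)) / (U n - L n)) atTop (𝓝 (deriv f d)) := by
  have hs : HasStrictDerivAt f (deriv f d) d :=
    hasStrictDerivAt_of_hasDerivAt_of_continuousAt (hf.mono fun x hx => hx.hasDerivAt) hc
  have h1 := hs.isLittleO.comp_tendsto (hU.prodMk_nhds hL)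
  have h2 := h1.tendsto_div_nhds_zero
  have h3 := h2.add_const (deriv f d)
  rw [zero_add] at h3
  refine h3.congr' ?_
  filter_upwards [hLU] with n hn
  have : U n - L n ≠ 0 := sub_ne_zero.2 hn.symm
  simp only [Function.comp_apply, ContinuousLinearMap.toSpanSingleton_apply, smul_eq_mul]
  field_simp
  ring

theorem firstSize_bounds {p : ℝ} (hp : p ∈ Ioo (0 : ℝ) 1) (n : ℕ) :
    (n : ℝ) * p - 1 ≤ firstSize p n ∧ (firstSize p n : ℝ) ≤ n * p + 1 := by
  have h0 : 0 ≤ (n : ℝ) * p := mul_nonneg n.cast_nonneg hp.1.le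
  have h1 := Nat.floor_le h0
  have h2 := Nat.lt_floor_add_one ((n : ℝ) * p)
  unfold firstSize
  split_ifs
  · constructor <;> linarith
  · push_cast
    constructor <;> linarith

theorem eventually_mul_le_firstSize {p : ℝ} (hp : p ∈ Ioo (0 : ℝ) 1) :
    ∀ᶠ n : ℕ in atTop, p / 2 * n ≤ firstSize p n := by
  filter_upwards [(tendsto_natCast_atTop_atTop (R := ℝ)).eventually_ge_atTop (2 / p)] with n hn
  rw [div_le_iff₀ hp.1] at hn
  linarith [(firstSize_bounds hp n).1]

theorem eventually_mul_le_secondSize {p : ℝ} (hp : p ∈ Ioo (0 : ℝ) 1) :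
    ∀ᶠ n : ℕ in atTop, (1 - p) / 4 * n ≤ secondSize p n := by
  have hp1 : 0 < 1 - p := by linarith [hp.2]
  filter_upwards [(tendsto_natCast_atTop_atTop (R := ℝ)).eventually_ge_atTop (6 / (1 - p))]
    with n hn
  rw [div_le_iff₀ hp1] at hn
  have h1 := (firstSize_bounds hp n).2
  -- The extra `1` covers rounding in the halving and avoids a parity argument.
  have h2 : n ≤ 2 * secondSize p n + 1 + firstSize p n := by
    unfold secondSize; omega
  have h3 : (n : ℝ) ≤ 2 * secondSize p n + 1 + firstSize p n := by exact_mod_cast h2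
  linarith

/-- The interval width is a power of `n₁`, but mean errors are controlled in powers of `n₂`; the two
sizes are comparable. -/
theorem exists_firstSize_rpow_le {p γ : ℝ} (hp : p ∈ Ioo (0 : ℝ) 1) (hγ : 0 < γ) :
    ∃ B : ℝ, 0 < B ∧ ∀ᶠ n : ℕ in atTop,
      (firstSize p n : ℝ) ^ γ ≤ B * (secondSize p n : ℝ) ^ γ := by
  have hp1 : 0 < 1 - p := by linarith [hp.2]
  -- From `n₁ ≤ 2n` and `n₂ ≥ (1 - p) n / 4`.
  refine ⟨(8 / (1 - p)) ^ γ, by positivity, ?_⟩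
  filter_upwards [eventually_mul_le_secondSize hp, eventually_ge_atTop 1] with n hn hn1
  have hn1' : (1 : ℝ) ≤ n := by exact_mod_cast hn1
  rw [← Real.mul_rpow (by positivity) (by positivity)]
  refine Real.rpow_le_rpow (by positivity) ?_ hγ.le
  have h1 := (firstSize_bounds hp n).2
  have h2 : (n : ℝ) * p ≤ n := mul_le_of_le_one_right (by positivity) hp.2.le
  calc (firstSize p n : ℝ) ≤ 8 / (1 - p) * ((1 - p) / 4 * n) := by
        field_simp; linarith
    _ ≤ _ := by gcongr

theorem tendsto_firstSize {p : ℝ} (hp : p ∈ Ioo (0 : ℝ) 1) :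
    Tendsto (firstSize p) atTop atTop := by
  rw [← tendsto_natCast_atTop_iff (R := ℝ)]
  exact tendsto_atTop_mono' _ (eventually_mul_le_firstSize hp)
    (tendsto_natCast_atTop_atTop.const_mul_atTop (by linarith [hp.1]))

theorem tendsto_secondSize {p : ℝ} (hp : p ∈ Ioo (0 : ℝ) 1) :
    Tendsto (secondSize p) atTop atTop := by
  rw [← tendsto_natCast_atTop_iff (R := ℝ)]
  exact tendsto_atTop_mono' _ (eventually_mul_le_secondSize hp)
    (tendsto_natCast_atTop_atTop.const_mul_atTop (by linarith [hp.2]))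

/-! ### Second moments, resampling rates and interval width -/

/-- The empirical second moments of the rows converge almost surely. -/
theorem ae_tendsto_mean_sq {Ω : Type*} [MeasurableSpace Ω] {P : Measure Ω}
    [IsProbabilityMeasure P] {Q : Measure ℝ} [IsProbabilityMeasure Q]
    (hA4 : AssumptionA4 Q) {m : ℕ → ℕ} {c : ℝ} (hc : 0 < c)
    (hm : ∀ᶠ n : ℕ in atTop, c * n ≤ m n) {X : (n : ℕ) → Fin (m n) → Ω → ℝ}
    (hX : ∀ n i, HasLaw (X n i) Q P) (hind : ∀ n, iIndepFun (X n) P) :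
    ∀ᵐ ω ∂P, Tendsto (fun n => (∑ i, X n i ω ^ 2) / m n) atTop (𝓝 (∫ e, e ^ 2 ∂Q)) := by
  set v := ∫ e, e ^ 2 ∂Q with hv
  have hφ : Measurable fun e : ℝ => e ^ 2 - v := by fun_prop
  have hlaw : HasLaw (fun e : ℝ => e ^ 2 - v) (Q.map fun e : ℝ => e ^ 2 - v) Q :=
    ⟨hφ.aemeasurable, rfl⟩
  have hmem2 : ∀ k : ℕ, MemLp (fun e : ℝ => e ^ 2 - v) k Q := by
    intro k
    refine MemLp.sub ?_ (memLp_const v)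
    rcases Nat.eq_zero_or_pos k with rfl | hk
    · simpa using (by fun_prop : AEStronglyMeasurable (fun e : ℝ => e ^ 2) Q)
    · have hk0 : (k : ENNReal) ≠ 0 := by exact_mod_cast hk.ne'
      rw [← integrable_norm_rpow_iff (by fun_prop) hk0 (by simp)]
      simpa [pow_mul] using hA4 (2 * k)
  have hmean : ∫ e, e ∂(Q.map fun e : ℝ => e ^ 2 - v) = 0 := by
    rw [integral_map hφ.aemeasurable (by fun_prop), integral_sub _ (integrable_const _)]
    · simp [hv]
    · simpa using hA4 2
  have hmom : ∀ k : ℕ, MemLp (fun e : ℝ => e) k (Q.map fun e : ℝ => e ^ 2 - v) := fun k => by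
    rw [memLp_map_measure_iff (by fun_prop) hφ.aemeasurable]
    exact hmem2 k
  -- The centred squares form an array of the same kind; exponent `0` gives a plain law of large
  -- numbers.
  have h := ae_tendsto_rpow_mul_mean (X := fun n i ω => X n i ω ^ 2 - v) hmean hmom hc hm
    (fun n i => hlaw.fun_comp (hX n i))
    (fun n => (hind n).comp (fun _ e => e ^ 2 - v) fun _ => hφ) (by norm_num : (0 : ℝ) < 1 / 2)
  filter_upwards [h] with ω hω
  have h2 := hω.add_const v
  rw [zero_add] at h2
  refine h2.congr' ?_
  filter_upwards [hm, eventually_gt_atTop 0] with n hn hn0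
  have hn0' : (0 : ℝ) < n := by exact_mod_cast hn0
  have hm0 : (0 : ℝ) < m n := lt_of_lt_of_le (by positivity) hn
  rw [Real.rpow_zero, one_mul, Finset.sum_sub_distrib, Finset.sum_const, Finset.card_univ,
    Fintype.card_fin, nsmul_eq_mul]
  field_simp
  ring

/-- The mean of a sample with replacement deviates from the mean of the sampled population by
more than `η / m₁ ^ γ` with vanishing probability, if the population size is at least of the order
of `m₁` and its second moments converge. -/
theorem tendsto_pi_uniformOn_abs_sub_mean {γ : ℝ} (hγ : γ < 1 / 2) {k m₁ : ℕ → ℕ} {B : ℝ}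
    (hk : Tendsto k atTop atTop)
    (hB' : ∀ᶠ n in atTop, (m₁ n : ℝ) ^ γ ≤ B * (k n : ℝ) ^ γ) (hm₁ : ∀ᶠ n in atTop, 0 < m₁ n)
    {e : (n : ℕ) → Fin (k n) → ℝ} {v : ℝ}
    (he : Tendsto (fun n => (∑ i, e n i ^ 2) / k n) atTop (𝓝 v)) {η : ℝ} (hη : 0 < η) :
    Tendsto (fun n => (Measure.pi fun _ : Fin (k n) => uniformOn (univ : Set (Fin (k n))))
      {r | η / (m₁ n : ℝ) ^ γ ≤ |(∑ i, e n (r i)) / k n - (∑ i, e n i) / k n|}) atTop (𝓝 0) := by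
  -- Chebyshev's bound is the mean square times `m₁^(2γ) / (k η²)`, hence `O(k^(2γ - 1))`.
  have h1 : Tendsto (fun n => (k n : ℝ) ^ (-(1 - 2 * γ))) atTop (𝓝 0) :=
    (tendsto_rpow_neg_atTop (by linarith)).comp (tendsto_natCast_atTop_atTop.comp hk)
  have h2 := ENNReal.tendsto_ofReal ((he.mul h1).mul_const ((B / η) ^ 2))
  rw [mul_zero, zero_mul, ENNReal.ofReal_zero] at h2
  refine tendsto_of_tendsto_of_tendsto_of_le_of_le' tendsto_const_nhds h2
    (Eventually.of_forall fun _ => zero_le) ?_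
  filter_upwards [hB', hm₁, hk.eventually_gt_atTop 0] with n hn hn1 hk0
  have hk0' : (0 : ℝ) < k n := by exact_mod_cast hk0
  have hn1' : (0 : ℝ) < m₁ n := by exact_mod_cast hn1
  refine (pi_uniformOn_abs_sub_mean_ge_le hk0 (e n) (by positivity)).trans
    (ENNReal.ofReal_le_ofReal ?_)
  have hS : 0 ≤ ∑ i, e n i ^ 2 := Finset.sum_nonneg fun i _ => sq_nonneg _
  have e1 : (k n : ℝ) ^ (-(1 - 2 * γ)) = ((k n : ℝ) ^ γ) ^ 2 / k n := by
    rw [neg_sub, Real.rpow_sub hk0', Real.rpow_one, mul_comm, Real.rpow_mul hk0'.le]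
    norm_cast
  rw [e1]
  calc (∑ i, e n i ^ 2) / (k n * (η / (m₁ n : ℝ) ^ γ)) ^ 2
      = (∑ i, e n i ^ 2) / k n * (((m₁ n : ℝ) ^ γ) ^ 2 / k n) * (1 / η) ^ 2 := by field_simp
    _ ≤ (∑ i, e n i ^ 2) / k n * ((B * (k n : ℝ) ^ γ) ^ 2 / k n) * (1 / η) ^ 2 := by gcongr
    _ = _ := by ring

theorem tendsto_rpow_firstSize_mul {p γ : ℝ} (hp : p ∈ Ioo (0 : ℝ) 1) (hγ : 0 < γ) {M : ℕ → ℝ}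
    (hM : Tendsto (fun n => (secondSize p n : ℝ) ^ γ * M n) atTop (𝓝 0)) :
    Tendsto (fun n => (firstSize p n : ℝ) ^ γ * M n) atTop (𝓝 0) := by
  obtain ⟨B, hB, hle⟩ := exists_firstSize_rpow_le hp hγ
  have h := hM.abs.const_mul B
  rw [abs_zero, mul_zero] at h
  refine squeeze_zero_norm' ?_ h
  filter_upwards [hle] with n hn
  rw [Real.norm_eq_abs, abs_mul, abs_mul, abs_of_nonneg (by positivity),
    abs_of_nonneg (by positivity : 0 ≤ (secondSize p n : ℝ) ^ γ), ← mul_assoc]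
  gcongr

theorem upperPoint_sub_lowerPoint (K γ : ℝ) (m : ℕ) (d : ℝ) :
    upperPoint K γ m d - lowerPoint K γ m d = 2 * K / (m : ℝ) ^ γ := by
  rw [upperPoint, lowerPoint, Real.rpow_neg m.cast_nonneg]
  ring

theorem tendsto_lowerPoint_upperPoint {K γ d₀ : ℝ} (hγ : 0 < γ) {m : ℕ → ℕ} {d : ℕ → ℝ}
    (hm : Tendsto m atTop atTop) (hd : Tendsto d atTop (𝓝 d₀)) :
    Tendsto (fun n => lowerPoint K γ (m n) (d n)) atTop (𝓝 d₀) ∧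
      Tendsto (fun n => upperPoint K γ (m n) (d n)) atTop (𝓝 d₀) := by
  have h := ((tendsto_rpow_neg_atTop hγ).comp (tendsto_natCast_atTop_atTop.comp hm)).const_mul K
  rw [mul_zero] at h
  exact ⟨by simpa [lowerPoint] using hd.sub h, by simpa [upperPoint] using hd.add h⟩

end TwoStage

/-! ### The theorem -/

theorem lemma2
    {Ω : Type*} [MeasurableSpace Ω] (P : Measure Ω) [IsProbabilityMeasure P]
    (p K γ d₀ : ℝ) (hp : p ∈ Set.Ioo (0 : ℝ) 1) (hK : 0 < K) (hγ : γ ∈ Set.Ioo (0 : ℝ) (1 / 2))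
    (hd₀ : d₀ ∈ Set.Ioo (0 : ℝ) 1)
    -- the regression function
    (f : ℝ → ℝ) (hf : f ∈ TwoStage.ClassF d₀) (hA3 : TwoStage.AssumptionA3 f)
    -- the design points
    (x : (m : ℕ) → Fin m → ℝ) (hx : TwoStage.IsDesignArray x) (hA2 : TwoStage.AssumptionA2 x)
    -- the law of the errors
    (Q : Measure ℝ) [IsProbabilityMeasure Q] (hQ : ∫ e, e ∂Q = 0) (hA4 : TwoStage.AssumptionA4 Q)
    -- the first-stage errors and the second-stage errors at the lower and at the upper point
    (ε : (n : ℕ) → Fin (TwoStage.firstSize p n) → Ω → ℝ)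
    (ε' ε'' : (n : ℕ) → Fin (TwoStage.secondSize p n) → Ω → ℝ)
    (hε : ∀ n i, HasLaw (ε n i) Q P)
    (hε' : ∀ n i, HasLaw (ε' n i) Q P)
    (hε'' : ∀ n i, HasLaw (ε'' n i) Q P)
    (hindep : ∀ n, iIndepFun (Sum.elim (ε n) (Sum.elim (ε' n) (ε'' n))) P)
    -- the isotonic regression estimate from the first-stage data
    (fhat : ℕ → Ω → ℝ → ℝ)
    (hfhat : ∀ n ω, TwoStage.IsIsotonicRegression (x (TwoStage.firstSize p n))
      (fun i => f (x (TwoStage.firstSize p n) i) + ε n i ω) (fhat n ω))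
    -- the first-stage estimate of `d₀`
    (dhat : ℕ → Ω → ℝ) (hdhat : ∀ n ω, dhat n ω = TwoStage.genInverse (fhat n ω) (f d₀))
    -- the second-stage sampling points
    (L U : ℕ → Ω → ℝ)
    (hL : ∀ n ω, L n ω = TwoStage.lowerPoint K γ (TwoStage.firstSize p n) (dhat n ω))
    (hU : ∀ n ω, U n ω = TwoStage.upperPoint K γ (TwoStage.firstSize p n) (dhat n ω))
    -- the second-stage responses
    (Y' Y'' : (n : ℕ) → Ω → Fin (TwoStage.secondSize p n) → ℝ)
    (hY' : ∀ n ω i, Y' n ω i = f (L n ω) + ε' n i ω)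
    (hY'' : ∀ n ω i, Y'' n ω i = f (U n ω) + ε'' n i ω)
    -- the least squares estimates (intercept, slope)
    (βhat : ℕ → Ω → ℝ × ℝ)
    (hβhat : ∀ n ω, TwoStage.IsLeastSquaresFit (L n ω) (U n ω) (Y' n ω) (Y'' n ω) (βhat n ω))
    -- the bootstrapped least squares estimates, as functions of the resampled indices `(r, s)`
    (βstar : (n : ℕ) → Ω →
      (Fin (TwoStage.secondSize p n) → Fin (TwoStage.secondSize p n)) ×
        (Fin (TwoStage.secondSize p n) → Fin (TwoStage.secondSize p n)) → ℝ × ℝ)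
    (hβstar : ∀ n ω r s, TwoStage.IsLeastSquaresFit (L n ω) (U n ω)
      (fun i => Y' n ω (r i)) (fun i => Y'' n ω (s i)) (βstar n ω (r, s))) :
    (∀ᵐ ω ∂P, Tendsto (fun n => (βhat n ω).2) atTop (𝓝 (deriv f d₀))) ∧
    (∀ᵐ ω ∂P, ∀ δ : ℝ, 0 < δ →
      Tendsto (fun n => TwoStage.bootstrapMeasure (TwoStage.secondSize p n)
        {rs | δ ≤ |(βstar n ω rs).2 - deriv f d₀|}) atTop (𝓝 0)) := by
  have hγ0 := hγ.1
  have hc₁ : 0 < p / 2 := by linarith [hp.1]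
  have hc₂ : 0 < (1 - p) / 4 := by linarith [hp.2]
  have hm₁ := TwoStage.eventually_mul_le_firstSize hp
  have hm₂ := TwoStage.eventually_mul_le_secondSize hp
  have hindε : ∀ n, iIndepFun (ε n) P := fun n =>
    iIndepFun.precomp (g := Sum.inl) Sum.inl_injective (hindep n)
  have hindε' : ∀ n, iIndepFun (ε' n) P := fun n =>
    iIndepFun.precomp (g := Sum.inr ∘ Sum.inl)
      (Sum.inr_injective.comp Sum.inl_injective) (hindep n)
  have hindε'' : ∀ n, iIndepFun (ε'' n) P := fun n =>
    iIndepFun.precomp (g := Sum.inr ∘ Sum.inr)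
      (Sum.inr_injective.comp Sum.inr_injective) (hindep n)
  have hfirst := TwoStage.tendsto_firstSize hp
  have hsecond := TwoStage.tendsto_secondSize hp
  obtain ⟨B, -, hBle⟩ := TwoStage.exists_firstSize_rpow_le hp hγ0
  -- almost sure behaviour of the errors
  have hsum := TwoStage.ae_eventually_abs_sum_Icc_lt hQ hA4.memLp hc₁ hm₁ hε hindε
  have hmean' := TwoStage.ae_tendsto_rpow_mul_mean hQ hA4.memLp hc₂ hm₂ hε' hindε' hγ.2
  have hmean'' := TwoStage.ae_tendsto_rpow_mul_mean hQ hA4.memLp hc₂ hm₂ hε'' hindε'' hγ.2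
  have hsq' := TwoStage.ae_tendsto_mean_sq hA4 hc₂ hm₂ hε' hindε'
  have hsq'' := TwoStage.ae_tendsto_mean_sq hA4 hc₂ hm₂ hε'' hindε''
  -- the width of the second-stage interval
  have hwidth : ∀ n ω, U n ω - L n ω = 2 * K / (TwoStage.firstSize p n : ℝ) ^ γ := fun n ω => by
    rw [hU, hL, TwoStage.upperPoint_sub_lowerPoint]
  -- Only eventually: if `n₁ = 0`, the convention `0 ^ (-γ) = 0` makes `L` and `U` coincide.
  have hne : ∀ᶠ n in atTop, ∀ ω, L n ω ≠ U n ω := by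
    filter_upwards [hfirst.eventually_gt_atTop 0] with n hn ω h
    have hn' : (0 : ℝ) < TwoStage.firstSize p n := by exact_mod_cast hn
    have h1 := hwidth n ω
    rw [h, sub_self] at h1
    have : 0 < 2 * K / (TwoStage.firstSize p n : ℝ) ^ γ := by positivity
    linarith
  have hβ : ∀ᶠ n in atTop, ∀ ω, (βhat n ω).2 = (f (U n ω) - f (L n ω)) / (U n ω - L n ω) +
      ((∑ i, ε'' n i ω) / TwoStage.secondSize p n - (∑ i, ε' n i ω) / TwoStage.secondSize p n) /
        (U n ω - L n ω) := by
    filter_upwards [hne, hsecond.eventually_gt_atTop 0] with n hn hk ω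
    have h := hβhat n ω
    rw [funext (hY' n ω), funext (hY'' n ω)] at h
    exact h.snd_eq_add hk (hn ω)
  have hβs : ∀ᶠ n in atTop, ∀ ω r s, (βstar n ω (r, s)).2 =
      (f (U n ω) - f (L n ω)) / (U n ω - L n ω) +
      ((∑ i, ε'' n (s i) ω) / TwoStage.secondSize p n -
        (∑ i, ε' n (r i) ω) / TwoStage.secondSize p n) / (U n ω - L n ω) := by
    filter_upwards [hne, hsecond.eventually_gt_atTop 0] with n hn hk ω r s
    have h := hβstar n ω r s
    simp only [hY', hY''] at h
    exact h.snd_eq_add hk (hn ω)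
  have hslope : ∀ᵐ ω ∂P, Tendsto (fun n => (βhat n ω).2) atTop (𝓝 (deriv f d₀)) := by
    filter_upwards [hsum, hmean', hmean''] with ω hs h' h''
    have hd : Tendsto (fun n => dhat n ω) atTop (𝓝 d₀) := by
      simp_rw [hdhat]
      exact TwoStage.tendsto_genInverse hx hA2 hA3.strictMonoOn hd₀ hfirst hs fun n => hfhat n ω
    obtain ⟨hLt, hUt⟩ := TwoStage.tendsto_lowerPoint_upperPoint (K := K) hγ0 hfirst hd
    have h1 := TwoStage.tendsto_slope_of_tendsto (hf.1.2.mono fun _ h => h.1)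
      hf.1.2.self_of_nhds.2.2 hLt hUt (hne.mono fun n hn => by simpa only [← hL, ← hU] using hn ω)
    simp only [← hL, ← hU] at h1
    have h2 := ((TwoStage.tendsto_rpow_firstSize_mul hp hγ0 h'').sub
      (TwoStage.tendsto_rpow_firstSize_mul hp hγ0 h')).div_const (2 * K)
    rw [sub_zero, zero_div] at h2
    have h3 := h1.add h2
    rw [add_zero] at h3
    refine h3.congr' ?_
    filter_upwards [hβ, hfirst.eventually_gt_atTop 0] with n hn hn0
    have hn0' : (0 : ℝ) < TwoStage.firstSize p n := by exact_mod_cast hn0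
    have : 0 < (TwoStage.firstSize p n : ℝ) ^ γ := by positivity
    rw [hn ω, hwidth]
    field_simp
  refine ⟨hslope, ?_⟩
  filter_upwards [hslope, hsq', hsq''] with ω hω h' h'' δ hδ
  -- Two deviations below `(K δ / 2) n₁^(-γ)`, divided by the width `2K n₁^(-γ)`, contribute less
  -- than `δ / 2`; the other `δ / 2` is left for `βhat`.
  have hη : 0 < K * δ / 2 := by positivity
  have hpos := hfirst.eventually_gt_atTop 0
  have t' := TwoStage.tendsto_pi_uniformOn_abs_sub_mean hγ.2 hsecond hBle hpos h' hη
  have t'' := TwoStage.tendsto_pi_uniformOn_abs_sub_mean hγ.2 hsecond hBle hpos h'' hη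
  have t := t'.add t''
  rw [add_zero] at t
  refine tendsto_of_tendsto_of_tendsto_of_le_of_le' tendsto_const_nhds t
    (Eventually.of_forall fun _ => zero_le) ?_
  filter_upwards [hβ, hβs, hpos, hsecond.eventually_gt_atTop 0,
    (Metric.tendsto_nhds.1 hω) (δ / 2) (by positivity)] with n hn hns hn0 hk hclose
  refine le_trans (measure_mono ?_) (TwoStage.bootstrapMeasure_union_le hk _ _)
  rintro ⟨r, s⟩ hrs
  rw [mem_ofPred_eq] at hrs ⊢
  by_contra! hcon
  obtain ⟨h1, h2⟩ := hcon
  simp only [mem_ofPred_eq, not_le] at h1 h2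
  have hn0' : (0 : ℝ) < TwoStage.firstSize p n := by exact_mod_cast hn0
  have hw : 0 < (TwoStage.firstSize p n : ℝ) ^ γ := by positivity
  rw [Real.dist_eq] at hclose
  set a' := (∑ i, ε' n (r i) ω) / TwoStage.secondSize p n -
    (∑ i, ε' n i ω) / TwoStage.secondSize p n with ha'
  set a'' := (∑ i, ε'' n (s i) ω) / TwoStage.secondSize p n -
    (∑ i, ε'' n i ω) / TwoStage.secondSize p n with ha''
  have hdiff : (βstar n ω (r, s)).2 - (βhat n ω).2 =
      (a'' - a') / (2 * K / (TwoStage.firstSize p n : ℝ) ^ γ) := by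
    rw [hn ω, hns ω, hwidth, add_sub_add_left_eq_sub, ← sub_div, ha', ha'']
    ring
  have hsmall : |(βstar n ω (r, s)).2 - (βhat n ω).2| < δ / 2 := by
    rw [hdiff, abs_div, abs_of_pos (by positivity : 0 < 2 * K / (TwoStage.firstSize p n : ℝ) ^ γ),
      div_lt_iff₀ (by positivity)]
    calc |a'' - a'| ≤ |a''| + |a'| := abs_sub _ _
      _ < K * δ / 2 / (TwoStage.firstSize p n : ℝ) ^ γ +
          K * δ / 2 / (TwoStage.firstSize p n : ℝ) ^ γ :=
        add_lt_add h2 h1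
      _ = _ := by ring
  have := abs_sub_le (βstar n ω (r, s)).2 (βhat n ω).2 (deriv f d₀)
  linarith
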